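/- Let $(R,\mathfrak m)$ be a Noetherian local ring of prime characteristic $p>0$ which is equidimensional (that is, $\dim R/P=\dim R$ for every minimal prime $P$ of $R$) and which is a homomorphic image of a Cohen–Macaulay ring. Let $d=\dim R$ and let $x_1,\dots,x_d$ be a system of parameters of $R$, i.e. elements of $\mathfrak m$ generating an $\mathfrak m$-primary ideal. For an ideal $I$ of $R$ and $q=p^e$ let $I^{[q]}=(a^q : a\in I)$; the tight closure $I^*$ of $I$ is the ideal of all $z\in R$ for which there is an element $c$ of $R$, lying in no minimal prime of $R$, with $cz^q\in I^{[q]}$ for all sufficiently large $q=p^e$. Let $\lambda$ denote the length of an $R$-module. Then: 1. For all integers $k_1,\dots,k_d\ge 1$, $$\lambda\big(R/(x_1^{k_1},\dots,x_d^{k_d})^*\big)\ \ge\ k_1\cdots k_d\;\lambda\big(R/(x_1,\dots,x_d)^*\big).$$ 2. For every $i\in\{1,\dots,d\}$ and every integer $k\ge 1$, writing $J=(x_1,\dots,x_d)$ and $J_{i,k}=(x_1,\dots,x_{i-1},x_i^{k},x_{i+1},\dots,x_d)$: if $\lambda(R/J_{i,k}^*)=k\,\lambda(R/J^*)$, then $J^*=J+J_{i,k}^*$.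 -/

import Mathlib

namespace TightClosureIneq

/-- The depth of a local ring: the supremum of the lengths of the regular sequences
that are contained in the maximal ideal. -/
noncomputable def localDepth (S : Type*) [CommRing S] [IsLocalRing S] : ℕ∞ :=
  ⨆ (rs : List S) (_ : RingTheory.Sequence.IsRegular S rs ∧
    ∀ r ∈ rs, r ∈ IsLocalRing.maximalIdeal S), (rs.length : ℕ∞)

/-- A Cohen-Macaulay local ring: Noetherian, with depth equal to the Krull dimension. -/
structure IsCohenMacaulayLocalRing (S : Type*) [CommRing S] [IsLocalRing S] : Prop where
  noetherian : IsNoetherianRing S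
  depth_eq : (localDepth S : WithBot ℕ∞) = ringKrullDim S

/-- A Cohen-Macaulay ring (not necessarily local): Noetherian, and every localization at a
maximal ideal is a Cohen-Macaulay local ring. -/
structure IsCohenMacaulayRing (S : Type*) [CommRing S] : Prop where
  noetherian : IsNoetherianRing S
  localization : ∀ (M : Ideal S) [M.IsMaximal],
    IsCohenMacaulayLocalRing (Localization.AtPrime M)

/-- `dim R/P = dim R` for every minimal prime `P` of `R`. -/
def IsEquidimensional (R : Type*) [CommRing R] : Prop :=
  ∀ P ∈ minimalPrimes R, ringKrullDim (R ⧸ P) = ringKrullDim R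

/-- `x_1, …, x_d` is a (full) system of parameters of the local ring `R`: `d = dim R`, and the
ideal `(x_1, …, x_d)` is primary to the maximal ideal. -/
structure IsSystemOfParameters {R : Type*} [CommRing R] [IsLocalRing R] {d : ℕ}
    (x : Fin d → R) : Prop where
  dim_eq : ringKrullDim R = d
  radical_eq : (Ideal.span (Set.range x)).radical = IsLocalRing.maximalIdeal R

/-- The Frobenius power `I^[q] = (a ^ q : a ∈ I)`. -/
def frobeniusPower {R : Type*} [CommRing R] (I : Ideal R) (q : ℕ) : Ideal R :=
  Ideal.span {b | ∃ a ∈ I, b = a ^ q}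

/-- `R°`: the elements of `R` that lie in no minimal prime of `R`. -/
def avoidMinimalPrimes (R : Type*) [CommRing R] : Submonoid R where
  carrier := {c | ∀ P ∈ minimalPrimes R, c ∉ P}
  one_mem' := fun _ hP h => hP.1.1.ne_top ((Ideal.eq_top_iff_one _).2 h)
  mul_mem' := fun ha hb P hP h => (hP.1.1.mem_or_mem h).elim (ha P hP) (hb P hP)

/-- The tight closure `I^*` in a ring of prime characteristic `p`: those `z` for which there is
`c ∈ R°` with `c z^q ∈ I^[q]` for all sufficiently large `q = p^e`. -/
def tightClosure {R : Type*} [CommRing R] (p : ℕ) [Fact p.Prime] [CharP R p]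
    (I : Ideal R) : Ideal R where
  carrier := {z | ∃ c ∈ avoidMinimalPrimes R, ∃ e₀ : ℕ, ∀ e ≥ e₀,
    c * z ^ p ^ e ∈ frobeniusPower I (p ^ e)}
  zero_mem' := ⟨1, one_mem _, 0, fun e _ => by
    rw [zero_pow (pow_ne_zero e (Fact.out : p.Prime).ne_zero), mul_zero]
    exact zero_mem _⟩
  add_mem' := by
    rintro y z ⟨b, hb, m, hm⟩ ⟨c, hc, n, hn⟩
    refine ⟨b * c, mul_mem hb hc, max m n, fun e he => ?_⟩
    have h1 := Ideal.mul_mem_left _ c (hm e (le_trans (le_max_left m n) he))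
    have h2 := Ideal.mul_mem_left _ b (hn e (le_trans (le_max_right m n) he))
    have h3 := add_mem h1 h2
    rw [add_pow_char_pow]
    convert h3 using 1
    ring
  smul_mem' := by
    rintro r z ⟨c, hc, n, hn⟩
    refine ⟨c, hc, n, fun e he => ?_⟩
    have h := Ideal.mul_mem_left _ (r ^ p ^ e) (hn e he)
    rw [smul_eq_mul, mul_pow]
    convert h using 1
    ring

end TightClosureIneq

/-!
The proof has two halves.

**Lengths.** Write `T(k) = (x₁^{k₁}, …, x_d^{k_d})^*`, let `eᵢ` be the `i`-th unit vector, and let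
`k[i := 1]` be `k` with its `i`-th entry replaced by `1`. Multiplication by `xᵢ` gives an exact
sequence `0 → R/(T(k + eᵢ) : xᵢ) → R/T(k + eᵢ) → R/(T(k + eᵢ) + xᵢR) → 0`. If
`T(k + eᵢ) : xᵢ ⊆ T(k)`, then, because `T(k + eᵢ) + xᵢR ⊆ T(k[i := 1])`, the length of `R/T(k + eᵢ)`
is at least the sum of the lengths of `R/T(k)` and `R/T(k[i := 1])`
(`length_quotient_tightClosure_add_le`). Induction on each exponent gives the inequality
(`prod_mul_length_le_length`). In the case of equality the last of these steps is an equality of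
finite lengths, so `T((1, …, 1)[i := k]) + xᵢR` is all of `(x₁, …, x_d)^*`.

**Colon capturing.** The inclusion `T(k + eᵢ) : xᵢ ⊆ T(k)` follows from the existence of one element
`c` of `R°` that multiplies the coefficients of every relation `∑ xⱼ^{kⱼ} zⱼ = 0`, for all positive
exponents at once, into the ideals generated by the other powers (`exists_mul_mem_span`). After
localizing, `R = S/I` with `S` Cohen-Macaulay local. There are `dim S - dim R` elements of `I`,
generating an ideal `K`, and lifts of the `xⱼ`, which together form a system of parameters of `S`
(`exists_lift_ringKrullDim_quotient_le`). In `S` every system of parameters is a regular sequence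
(`isWeaklyRegular_of_maximalIdeal_le_radical`), so all powers of the lifts are regular on
`N = S/K`. As `R` is equidimensional and `dim N = dim R`, the primes over `K` that do not meet the
preimage `W` of `R°` are minimal over `K`, hence associated to `N`.

In this situation an element of `W` annihilates the first Koszul homology of every `N`-regular
sequence of length `n` with coefficients in a given finite module `M` killed by `K`
(`exists_killsKoszulRelations`). By prime filtration it is enough to treat `M = S/Q`. If `Q` meets
`W`, then an element of `W` kills `M`. Otherwise `S/Q` embeds into `N`, and the first Koszul
homology of the submodule is controlled by that of the cokernel for the sequence of length `n - 1`,
so induction on `n` applies. The ring `S` need not have characteristic `p`, which is why no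
Frobenius is used in this half.
-/

namespace TightClosureIneq

open RingTheory.Sequence IsLocalRing

/-! ### Koszul relations with uniform annihilators -/

/-- `c` annihilates the first Koszul homology of `x` with coefficients in `M`: after multiplication
by `c`, every relation `∑ x j • m j = 0` is a combination of the trivial relations. The alternating
matrix exhibiting this is written as `s j k - s k j`, with `s` arbitrary. -/
def KillsKoszulRelations {S : Type*} [CommRing S] {n : ℕ} (c : S) (x : Fin n → S) (M : Type*)
    [AddCommGroup M] [Module S M] : Prop :=
  ∀ m : Fin n → M, ∑ j, x j • m j = 0 →
    ∃ s : Fin n → Fin n → M, ∀ j, c • m j = ∑ k, x k • (s j k - s k j)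

section Koszul

variable {S : Type*} [CommRing S] {n : ℕ}

theorem sum_smul_alternating {M : Type*} [AddCommGroup M] [Module S M]
    (x : Fin n → S) (s : Fin n → Fin n → M) :
    ∑ j, x j • ∑ k, x k • (s j k - s k j) = 0 := by
  simp only [smul_sub, Finset.sum_sub_distrib, Finset.smul_sum]
  rw [sub_eq_zero, Finset.sum_comm]
  refine Finset.sum_congr rfl fun i _ => Finset.sum_congr rfl fun j _ => ?_
  rw [smul_smul, smul_smul, mul_comm]

theorem KillsKoszulRelations.of_smul_eq_zero {M : Type*} [AddCommGroup M] [Module S M]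
    {c : S} (x : Fin n → S) (h : ∀ m : M, c • m = 0) : KillsKoszulRelations c x M :=
  fun m _ => ⟨0, fun j => by simp [h]⟩

theorem KillsKoszulRelations.of_exact {M₁ M₂ M₃ : Type*} [AddCommGroup M₁] [Module S M₁]
    [AddCommGroup M₂] [Module S M₂] [AddCommGroup M₃] [Module S M₃]
    {f : M₁ →ₗ[S] M₂} {g : M₂ →ₗ[S] M₃} (hf : Function.Injective f) (hg : Function.Surjective g)
    (hfg : Function.Exact f g) {a b : S} {x : Fin n → S}
    (h₁ : KillsKoszulRelations a x M₁) (h₃ : KillsKoszulRelations b x M₃) :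
    KillsKoszulRelations (a * b) x M₂ := by
  intro m hm
  obtain ⟨s, hs⟩ := h₃ (fun j => g (m j)) (by simpa using congrArg g hm)
  choose t ht using fun j k => hg (s j k)
  have hker : ∀ j, g (b • m j - ∑ k, x k • (t j k - t k j)) = 0 := fun j => by
    simp [ht, hs]
  choose w hw using fun j => (hfg _).1 (hker j)
  obtain ⟨r, hr⟩ := h₁ w (hf (by
    rw [map_sum, map_zero]
    simp only [map_smul, hw, smul_sub, Finset.sum_sub_distrib]
    have h1 := sum_smul_alternating x t
    simp only [smul_sub, Finset.sum_sub_distrib] at h1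
    rw [h1, sub_zero]
    simp only [smul_comm (x _) b, ← Finset.smul_sum, hm, smul_zero]))
  refine ⟨fun j k => f (r j k) + a • t j k, fun j => ?_⟩
  have h2 : (a * b) • m j = a • f (w j) + a • ∑ k, x k • (t j k - t k j) := by
    rw [hw, smul_sub, mul_smul]; abel
  rw [h2, ← map_smul, hr, map_sum, Finset.smul_sum, ← Finset.sum_add_distrib]
  refine Finset.sum_congr rfl fun k _ => ?_
  rw [map_smul, smul_comm a, ← smul_add, map_sub, smul_sub]
  congr 1
  module

theorem ofList_ofFn (x : Fin n → S) : Ideal.ofList (List.ofFn x) = Ideal.span (Set.range x) := by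
  unfold Ideal.ofList
  congr 1
  ext a
  simp [List.mem_ofFn]

theorem mem_span_range_smul_top_iff {N : Type*} [AddCommGroup N] [Module S N] (x : Fin n → S)
    (v : N) : v ∈ (Ideal.span (Set.range x) • ⊤ : Submodule S N) ↔
      ∃ b : Fin n → N, v = ∑ j, x j • b j := by
  constructor
  · intro h
    induction h using Submodule.smul_induction_on' with
    | smul r hr m _ =>
      obtain ⟨c, rfl⟩ := Ideal.mem_span_range_iff_exists_fun.1 hr
      exact ⟨fun j => c j • m, by
        rw [Finset.sum_smul]
        exact Finset.sum_congr rfl fun j _ => by rw [smul_smul, mul_comm]⟩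
    | add a _ b _ ha hb =>
      obtain ⟨s, rfl⟩ := ha
      obtain ⟨t, rfl⟩ := hb
      exact ⟨s + t, by simp [Finset.sum_add_distrib]⟩
  · rintro ⟨b, rfl⟩
    exact sum_mem fun j _ => Submodule.smul_mem_smul (Ideal.subset_span ⟨j, rfl⟩) trivial

/-- The extra element of a regular sequence of length `n + 1` on `N` allows passing from Koszul
relations on the cokernel to Koszul relations on a submodule: `a` makes
`D ⧸ (x₁, …, xₙ) D → N ⧸ (x₁, …, xₙ) N` injective, on whose target the last element is regular. -/
theorem KillsKoszulRelations.succ_of_exact {D N E : Type*} [AddCommGroup D] [Module S D]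
    [AddCommGroup N] [Module S N] [AddCommGroup E] [Module S E]
    {f : D →ₗ[S] N} {g : N →ₗ[S] E} (hf : Function.Injective f) (hg : Function.Surjective g)
    (hfg : Function.Exact f g) {a b : S} {x : Fin (n + 1) → S}
    (hx : IsWeaklyRegular N (List.ofFn x))
    (hE : KillsKoszulRelations a (fun j : Fin n => x j.castSucc) E)
    (hD : KillsKoszulRelations b (fun j : Fin n => x j.castSucc) D) :
    KillsKoszulRelations (b * a) x D := by
  rw [List.ofFn_succ', List.concat_eq_append, isWeaklyRegular_append_iff,
    isWeaklyRegular_singleton_iff, ofList_ofFn] at hx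
  obtain ⟨-, hx⟩ := hx
  intro m hm
  rw [Fin.sum_univ_castSucc] at hm
  have hmem : f (m (Fin.last n)) ∈
      (Ideal.span (Set.range fun j : Fin n => x j.castSucc) • ⊤ : Submodule S N) := by
    rw [← Submodule.Quotient.mk_eq_zero]
    apply hx
    simp only
    rw [smul_zero, ← Submodule.Quotient.mk_smul, Submodule.Quotient.mk_eq_zero,
      mem_span_range_smul_top_iff]
    refine ⟨fun j => f (-m j.castSucc), ?_⟩
    rw [← map_smul, eq_neg_of_add_eq_zero_right hm]
    simp
  obtain ⟨v, hv⟩ := (mem_span_range_smul_top_iff _ _).1 hmem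
  obtain ⟨s, hs⟩ := hE (fun j => g (v j)) (by
    simpa [hfg.apply_apply_eq_zero] using (congrArg g hv).symm)
  choose t ht using fun j k => hg (s j k)
  have hker : ∀ j, g (a • v j - ∑ k : Fin n, x k.castSucc • (t j k - t k j)) = 0 := fun j => by
    simp [ht, hs]
  choose w hw using fun j => (hfg _).1 (hker j)
  -- `w` expresses `a • m (last)` as a combination of the other elements inside `D`
  have hw' : a • m (Fin.last n) = ∑ j : Fin n, x j.castSucc • w j := by
    apply hf
    rw [map_smul, hv, map_sum]
    simp only [map_smul, hw, smul_sub, Finset.sum_sub_distrib]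
    have h1 := sum_smul_alternating (fun j : Fin n => x j.castSucc) t
    simp only [smul_sub, Finset.sum_sub_distrib] at h1
    rw [h1, sub_zero, Finset.smul_sum]
    exact Finset.sum_congr rfl fun j _ => smul_comm _ _ _
  obtain ⟨r, hr⟩ := hD (fun j => a • m j.castSucc + x (Fin.last n) • w j) (by
    simp only [smul_add, Finset.sum_add_distrib, smul_comm _ a, smul_comm _ (x (Fin.last n)),
      ← Finset.smul_sum]
    rw [← hw', smul_comm _ a, ← smul_add, hm, smul_zero])
  refine ⟨Fin.snoc (fun j => Fin.snoc (r j) 0) (Fin.snoc (fun j => b • w j) 0), fun j => ?_⟩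
  rw [Fin.sum_univ_castSucc]
  refine Fin.lastCases ?_ (fun j => ?_) j
  · simp only [Fin.snoc_last, Fin.snoc_castSucc, sub_zero, mul_smul, hw', Finset.smul_sum,
      sub_self, smul_zero, add_zero]
    exact Finset.sum_congr rfl fun j _ => smul_comm _ _ _
  · simp only [Fin.snoc_last, Fin.snoc_castSucc, zero_sub, ← hr, mul_smul, smul_add, smul_neg,
      smul_comm b (x (Fin.last n))]
    abel

end Koszul

/-- The element `c` depends on `M` and on the length `n`, but not on the sequence, so it serves all
powers of a system of parameters at once. -/
theorem exists_killsKoszulRelations.{u} {S : Type u} [CommRing S] [IsNoetherianRing S]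
    (N : Type u) [AddCommGroup N] [Module S N] [Module.Finite S N]
    (K : Ideal S) (hK : ∀ k ∈ K, ∀ v : N, k • v = 0) (W : Submonoid S)
    (hW : ∀ Q : Ideal S, Q.IsPrime → K ≤ Q → (∀ c ∈ W, c ∉ Q) → IsAssociatedPrime Q N)
    (n : ℕ) (M : Type u) [AddCommGroup M] [Module S M] [hM : Module.Finite S M]
    (hKM : ∀ k ∈ K, ∀ v : M, k • v = 0) :
    ∃ c ∈ W, ∀ x : Fin n → S, IsWeaklyRegular N (List.ofFn x) → KillsKoszulRelations c x M := by
  induction n generalizing M with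
  | zero => exact ⟨1, one_mem _, fun x _ m _ => ⟨0, fun j => j.elim0⟩⟩
  | succ n ih =>
    revert hKM
    refine IsNoetherianRing.induction_on_isQuotientEquivQuotientPrime S hM
      (motive := fun L _ _ _ => (∀ k ∈ K, ∀ v : L, k • v = 0) → ∃ c ∈ W, ∀ x : Fin (n + 1) → S,
        IsWeaklyRegular N (List.ofFn x) → KillsKoszulRelations c x L) ?_ ?_ ?_
    · intro L _ _ _ _ _
      exact ⟨1, one_mem _, fun x _ => .of_smul_eq_zero x fun _ => Subsingleton.elim _ _⟩
    · intro L _ _ _ P e hKL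
      have hP : ∀ r ∈ P.1, ∀ v : L, r • v = 0 := fun r hr v => by
        apply e.injective
        obtain ⟨t, ht⟩ := Ideal.Quotient.mk_surjective (e v)
        rw [map_smul, map_zero, ← ht]
        exact Ideal.Quotient.eq_zero_iff_mem.2 (P.1.mul_mem_right t hr)
      have hKP : K ≤ P.1 := fun k hk => by
        have h1 := congrArg e (hKL k hk (e.symm 1))
        rw [map_smul, e.apply_symm_apply, map_zero] at h1
        have h2 : Ideal.Quotient.mk P.1 (k * 1) = 0 := h1
        rwa [mul_one, Ideal.Quotient.eq_zero_iff_mem] at h2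
      by_cases hd : ∃ c ∈ W, c ∈ P.1
      · obtain ⟨c, hc, hcP⟩ := hd
        exact ⟨c, hc, fun x _ => .of_smul_eq_zero x (hP c hcP)⟩
      · push Not at hd
        obtain ⟨φ, hφ⟩ := ((isAssociatedPrime_iff_exists_injective_linearMap _ _).1
          (hW P.1 P.2 hKP hd)).2
        have hf : Function.Injective (φ ∘ₗ e.toLinearMap) := hφ.comp e.injective
        obtain ⟨a, ha, hE⟩ := ih (N ⧸ LinearMap.range (φ ∘ₗ e.toLinearMap)) (by
          intro k hk v
          obtain ⟨v, rfl⟩ := Submodule.Quotient.mk_surjective _ v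
          rw [← Submodule.Quotient.mk_smul, hK k hk, Submodule.Quotient.mk_zero])
        obtain ⟨b, hb, hD⟩ := ih L hKL
        refine ⟨b * a, mul_mem hb ha, fun x hx => ?_⟩
        have hx' : IsWeaklyRegular N (List.ofFn fun j : Fin n => x j.castSucc) := by
          rw [List.ofFn_succ', List.concat_eq_append, isWeaklyRegular_append_iff] at hx
          exact hx.1
        exact .succ_of_exact hf (Submodule.mkQ_surjective _)
          (LinearMap.exact_map_mkQ_range _) hx (hE _ hx') (hD _ hx')
    · intro L₁ _ _ _ L₂ _ _ _ L₃ _ _ _ f g hf hg hfg h₁ h₃ hKL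
      obtain ⟨a, ha, h₁⟩ := h₁ fun k hk v => hf (by rw [map_smul, hKL k hk, map_zero])
      obtain ⟨b, hb, h₃⟩ := h₃ fun k hk v => by
        obtain ⟨v, rfl⟩ := hg v
        rw [← map_smul, hKL k hk, map_zero]
      exact ⟨a * b, mul_mem ha hb, fun x hx => .of_exact hf hg hfg (h₁ x hx) (h₃ x hx)⟩

/-! ### Systems of parameters of modules with a regular system of parameters -/

section ParametersRegular

variable {S : Type*} [CommRing S]

theorem smul_quotient_eq_zero_of_mem_sup_ofList {M : Type*} [AddCommGroup M] [Module S M]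
    {K : Ideal S} (hK : ∀ k ∈ K, ∀ v : M, k • v = 0) (l : List S) :
    ∀ k ∈ K ⊔ Ideal.ofList l, ∀ v : M ⧸ (Ideal.ofList l • ⊤ : Submodule S M), k • v = 0 := by
  intro k hk v
  obtain ⟨v, rfl⟩ := Submodule.Quotient.mk_surjective _ v
  obtain ⟨a, ha, b, hb, rfl⟩ := Submodule.mem_sup.1 hk
  rw [add_smul, ← Submodule.Quotient.mk_smul, hK a ha, Submodule.Quotient.mk_zero, zero_add,
    ← Submodule.Quotient.mk_smul, Submodule.Quotient.mk_eq_zero]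
  exact Submodule.smul_mem_smul hb trivial

theorem isSMulRegular_of_mem_radical {L : Type*} [AddCommGroup L] [Module S L] {J : Ideal S}
    (hJ : ∀ k ∈ J, ∀ v : L, k • v = 0) {b e : S} (hb : IsSMulRegular L b)
    (h : b ∈ (J ⊔ Ideal.span {e}).radical) : IsSMulRegular L e := by
  obtain ⟨N, hN⟩ := h
  obtain ⟨j, hj, y, hy, hjy⟩ := Submodule.mem_sup.1 hN
  obtain ⟨t, rfl⟩ := Ideal.mem_span_singleton'.1 hy
  intro v w hvw
  apply hb.pow N
  simp only at hvw ⊢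
  rw [← hjy, add_smul, add_smul, hJ j hj, hJ j hj, mul_smul, mul_smul, hvw]

variable [IsLocalRing S] [IsNoetherianRing S]

/-- By Krull's principal ideal theorem `S ⧸ I` has dimension at most one when `I` and `a` generate
an ideal primary to the maximal ideal, so the maximal ideal is the only prime over `I` that is not
minimal over `I`. -/
theorem maximalIdeal_le_radical_sup_span {I : Ideal S} (hI : I ≤ maximalIdeal S) {a e : S}
    (ha : a ∈ maximalIdeal S) (hIa : maximalIdeal S ≤ (I ⊔ Ideal.span {a}).radical)
    (he : ∀ Q ∈ I.minimalPrimes, Q ≠ maximalIdeal S → e ∉ Q) :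
    maximalIdeal S ≤ (I ⊔ Ideal.span {e}).radical := by
  rw [Ideal.radical_eq_sInf]
  refine le_sInf fun P ⟨hP, hPp⟩ => ?_
  by_contra hmP
  have hPm : P < maximalIdeal S := lt_of_le_not_ge (le_maximalIdeal hPp.ne_top) hmP
  have hIP : I ≤ P := le_sup_left.trans hP
  obtain ⟨Q, hQ, hQP⟩ := Ideal.exists_minimalPrimes_le hIP
  have hQp : Q.IsPrime := hQ.1.1
  have heP : e ∈ P := hP (Ideal.mem_sup_right (Ideal.mem_span_singleton_self e))
  have hlt : Q < P := lt_of_le_of_ne hQP (by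
    rintro rfl
    exact he _ hQ hPm.ne heP)
  have hmin : maximalIdeal S ∈ (I ⊔ Ideal.span {a}).minimalPrimes := by
    refine ⟨⟨inferInstance, sup_le hI ((Ideal.span_singleton_le_iff_mem _).2 ha)⟩, ?_⟩
    rintro P' ⟨hP', hle⟩ -
    exact hIa.trans (hP'.radical_le_iff.2 hle)
  have hh := Ideal.map_height_le_one_of_mem_minimalPrimes hmin
  have h1 := Ideal.isPrime_map_quotientMk_of_isPrime (p := Q) hQ.1.2
  have h2 := Ideal.isPrime_map_quotientMk_of_isPrime (p := P) hIP
  have h3 := Ideal.isPrime_map_quotientMk_of_isPrime (p := maximalIdeal S) hI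
  have hmono : ∀ {A B : Ideal S}, I ≤ A → I ≤ B → A < B →
      A.map (Ideal.Quotient.mk I) < B.map (Ideal.Quotient.mk I) := fun {A B} hA hB hAB =>
    lt_of_le_not_ge (Ideal.map_mono hAB.le) fun h => hAB.not_ge (by
      have := Ideal.comap_mono (f := Ideal.Quotient.mk I) h
      rwa [Ideal.comap_map_mk hA, Ideal.comap_map_mk hB] at this)
  have h4 := (Ideal.height_strict_mono_of_isPrime_of_isPrime (hmono hIP hI hPm)).trans_le hh
  have h5 := Ideal.height_strict_mono_of_isPrime_of_isPrime (hmono hQ.1.2 hIP hlt)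
  rw [Order.lt_one_iff] at h4
  rw [h4] at h5
  exact not_lt_bot h5

/-- If some sequence of length `n` that generates an ideal primary to the maximal ideal modulo `K`
is weakly regular on `M`, then so is every other such sequence. -/
theorem isWeaklyRegular_of_maximalIdeal_le_radical (n : ℕ) (M : Type*) [AddCommGroup M] [Module S M]
    [Module.Finite S M] (K : Ideal S) (hKm : K ≤ maximalIdeal S)
    (hK : ∀ k ∈ K, ∀ v : M, k • v = 0) (as xs : List S) (has : as.length = n) (hxs : xs.length = n)
    (ham : ∀ a ∈ as, a ∈ maximalIdeal S) (hxm : ∀ a ∈ xs, a ∈ maximalIdeal S)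
    (har : maximalIdeal S ≤ (K ⊔ Ideal.ofList as).radical)
    (hxr : maximalIdeal S ≤ (K ⊔ Ideal.ofList xs).radical)
    (hreg : IsWeaklyRegular M as) : IsWeaklyRegular M xs := by
  induction n generalizing M K as xs with
  | zero =>
    rw [List.length_eq_zero_iff] at hxs
    subst hxs
    exact .nil S M
  | succ n ih =>
    obtain rfl | ⟨as, a, rfl⟩ := as.eq_nil_or_concat'
    · simp at has
    obtain rfl | ⟨xs, x, rfl⟩ := xs.eq_nil_or_concat'
    · simp at hxs
    simp only [List.length_append, List.length_singleton, Nat.add_right_cancel_iff] at has hxs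
    simp only [List.mem_append, List.mem_singleton, or_imp, forall_and, forall_eq] at ham hxm
    rw [Ideal.ofList_append, Ideal.ofList_singleton, ← sup_assoc] at har hxr
    have hIa : K ⊔ Ideal.ofList as ≤ maximalIdeal S := sup_le hKm (Ideal.span_le.2 ham.1)
    have hIx : K ⊔ Ideal.ofList xs ≤ maximalIdeal S := sup_le hKm (Ideal.span_le.2 hxm.1)
    -- a parameter `e` that completes both truncated sequences
    obtain ⟨e, hem, he⟩ : ∃ e ∈ maximalIdeal S, ∀ Q ∈ ((K ⊔ Ideal.ofList as).minimalPrimes ∪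
        (K ⊔ Ideal.ofList xs).minimalPrimes) \ {maximalIdeal S}, e ∉ Q := by
      by_contra! hcon
      have hfin := (((K ⊔ Ideal.ofList as).finite_minimalPrimes_of_isNoetherianRing S).union
        ((K ⊔ Ideal.ofList xs).finite_minimalPrimes_of_isNoetherianRing S)).sdiff
        (t := {maximalIdeal S})
      have hpr : ∀ Q ∈ ((K ⊔ Ideal.ofList as).minimalPrimes ∪
        (K ⊔ Ideal.ofList xs).minimalPrimes) \ {maximalIdeal S}, Q.IsPrime := fun Q hQ =>
        hQ.1.elim (fun h => h.1.1) fun h => h.1.1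
      obtain ⟨Q, hQ, hle⟩ := (Ideal.subset_union_prime_finite hfin (f := id) ⊤ ⊤
        (fun Q hQ _ _ => hpr Q hQ) (I := maximalIdeal S)).1 fun e he => by
          obtain ⟨Q, hQ, heQ⟩ := hcon e he
          exact Set.mem_biUnion hQ heQ
      exact hQ.2 (le_antisymm (le_maximalIdeal (hpr Q hQ).ne_top) hle)
    have hea := maximalIdeal_le_radical_sup_span hIa ham.2 har fun Q hQ hne => he Q ⟨.inl hQ, hne⟩
    have hex := maximalIdeal_le_radical_sup_span hIx hxm.2 hxr fun Q hQ hne => he Q ⟨.inr hQ, hne⟩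
    rw [isWeaklyRegular_append_iff, isWeaklyRegular_singleton_iff] at hreg ⊢
    have hae : IsWeaklyRegular M (as ++ [e]) := by
      rw [isWeaklyRegular_append_iff, isWeaklyRegular_singleton_iff]
      exact ⟨hreg.1, isSMulRegular_of_mem_radical
        (smul_quotient_eq_zero_of_mem_sup_ofList hK as) hreg.2 (hea ham.2)⟩
    have hmem : ∀ l : List S, (∀ a ∈ l, a ∈ maximalIdeal S) →
        ∀ r ∈ l ++ [e], r ∈ maximalIdeal S := fun l hl r hr => by
      rw [List.mem_append, List.mem_singleton] at hr
      exact hr.elim (hl r) fun h => h ▸ hem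
    have hae' := isWeaklyRegular_of_perm_of_subset_maximalIdeal hae
      (List.perm_append_singleton e as) (hmem as ham.1)
    rw [isWeaklyRegular_cons_iff] at hae'
    have hxreg : IsWeaklyRegular (QuotSMulTop e M) xs := by
      refine ih (QuotSMulTop e M) (K ⊔ Ideal.span {e})
        (sup_le hKm ((Ideal.span_singleton_le_iff_mem _).2 hem)) ?_ as xs has hxs ham.1 hxm.1
        (by rwa [sup_right_comm]) (by rwa [sup_right_comm]) hae'.2
      intro k hk v
      obtain ⟨v, rfl⟩ := Submodule.Quotient.mk_surjective _ v
      obtain ⟨b, hb, y, hy, rfl⟩ := Submodule.mem_sup.1 hk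
      obtain ⟨t, rfl⟩ := Ideal.mem_span_singleton'.1 hy
      rw [← Submodule.Quotient.mk_smul, add_smul, hK b hb, zero_add, mul_comm, mul_smul,
        Submodule.Quotient.mk_eq_zero]
      exact Submodule.smul_mem_pointwise_smul _ _ _ trivial
    have hxe := isWeaklyRegular_of_perm_of_subset_maximalIdeal
      ((isWeaklyRegular_cons_iff M e xs).2 ⟨hae'.1, hxreg⟩)
      (List.perm_append_singleton e xs).symm (by
        intro r hr
        exact hmem xs hxm.1 r ((List.perm_append_singleton e xs).mem_iff.2 hr))
    rw [isWeaklyRegular_append_iff, isWeaklyRegular_singleton_iff] at hxe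
    exact ⟨hxe.1, isSMulRegular_of_mem_radical (smul_quotient_eq_zero_of_mem_sup_ofList hK xs) hxe.2
      (hxr hem)⟩

end ParametersRegular

/-! ### Dimension of quotients and lifting of parameters -/

section Dimension

variable {S : Type*} [CommRing S]

theorem ringKrullDim_quotient_antitone {K L : Ideal S} (h : K ≤ L) :
    ringKrullDim (S ⧸ L) ≤ ringKrullDim (S ⧸ K) :=
  ringKrullDim_le_of_surjective (Ideal.Quotient.factor h) (Ideal.Quotient.factor_surjective h)

theorem ringKrullDim_quotient_le_of_minimalPrimes {L : Ideal S} {m : WithBot ℕ∞}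
    (h : ∀ P ∈ L.minimalPrimes, ringKrullDim (S ⧸ P) ≤ m) : ringKrullDim (S ⧸ L) ≤ m := by
  rw [ringKrullDim_quotient, Order.krullDim]
  refine iSup_le fun l => ?_
  obtain ⟨P, hP, hle⟩ := Ideal.exists_minimalPrimes_le (J := l.head.1.asIdeal) l.head.2
  refine le_trans ?_ (h P hP)
  rw [ringKrullDim_quotient]
  let l' : LTSeries (PrimeSpectrum.zeroLocus (R := S) P) :=
    { length := l.length
      toFun := fun i => ⟨(l i).1, hle.trans (l.head_le i)⟩
      step := fun i => l.step i }
  exact Order.LTSeries.length_le_krullDim l'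

theorem ringKrullDim_quotient_add_one_le {Q P : Ideal S} [Q.IsPrime] (h : Q < P) :
    ringKrullDim (S ⧸ P) + 1 ≤ ringKrullDim (S ⧸ Q) := by
  obtain ⟨r, hrP, hrQ⟩ := SetLike.exists_of_lt h
  refine ringKrullDim_succ_le_of_surjective (Ideal.Quotient.factor h.le)
    (Ideal.Quotient.factor_surjective h.le) (r := Ideal.Quotient.mk Q r) ?_ ?_
  · rwa [mem_nonZeroDivisors_iff_ne_zero, ne_eq, Ideal.Quotient.eq_zero_iff_mem]
  · rwa [Ideal.Quotient.factor_mk, Ideal.Quotient.eq_zero_iff_mem]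

theorem le_of_add_natCast_le {a : WithBot ℕ∞} {m n : ℕ} (h : a + n ≤ (m + n : ℕ)) : a ≤ m := by
  induction a with
  | bot => exact bot_le
  | coe a =>
    have h1 : a + n ≤ (m : ℕ∞) + n := by exact_mod_cast h
    have h2 : a ≤ m := by simpa using h1
    exact_mod_cast h2

/-- Prime avoidance for a coset `x + I` and finitely many pairwise incomparable primes. -/
theorem exists_add_notMem_of_isAntichain {I : Ideal S} {x : S} {T : Set (Ideal S)} (hT : T.Finite)
    (hp : ∀ Q ∈ T, Q.IsPrime) (hanti : IsAntichain (· ≤ ·) T)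
    (h : ∀ Q ∈ T, ¬ I ⊔ Ideal.span {x} ≤ Q) : ∃ u ∈ I, ∀ Q ∈ T, x + u ∉ Q := by
  classical
  set T₁ := {Q ∈ T | x ∈ Q} with hT₁
  have hT₂ : {Q ∈ T | x ∉ Q}.Finite := hT.subset fun _ h => h.1
  -- `u` lies in `I` and in the primes avoiding `x`, but in none of those containing `x`
  set J := I ⊓ hT₂.toFinset.inf id with hJ
  obtain ⟨u, huJ, hu⟩ : ∃ u ∈ J, ∀ Q ∈ T₁, u ∉ Q := by
    by_contra! hcon
    obtain ⟨Q, hQ, hle⟩ := (Ideal.subset_union_prime_finite (hT.subset fun _ h => h.1 : T₁.Finite)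
      (f := id) ⊤ ⊤ (fun Q hQ _ _ => hp Q hQ.1) (I := J)).1 fun e he => by
        obtain ⟨Q, hQ, heQ⟩ := hcon e he
        exact Set.mem_biUnion hQ heQ
    have hQp := hp Q hQ.1
    rcases hQp.inf_le.1 hle with h1 | h1
    · exact h Q hQ.1 (sup_le h1 ((Ideal.span_singleton_le_iff_mem _).2 hQ.2))
    · obtain ⟨Q', hQ', hle'⟩ := hQp.inf_le'.1 h1
      rw [Set.Finite.mem_toFinset] at hQ'
      have : Q' = Q := hanti.eq hQ'.1 hQ.1 hle'
      exact hQ'.2 (this ▸ hQ.2)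
  refine ⟨u, huJ.1, fun Q hQ hmem => ?_⟩
  by_cases hxQ : x ∈ Q
  · exact hu Q ⟨hQ, hxQ⟩ ((Q.add_mem_iff_right hxQ).1 hmem)
  · refine hxQ ((Q.add_mem_iff_left ?_).1 hmem)
    exact (Finset.inf_le (f := id) (hT₂.mem_toFinset.2 ⟨hQ, hxQ⟩) : _ ≤ Q) huJ.2

theorem exists_ringKrullDim_quotient_sup_span_le [IsNoetherianRing S] {K I : Ideal S} {x : S}
    {m : ℕ} (hK : ringKrullDim (S ⧸ K) ≤ (m + 1 : ℕ))
    (hKI : ringKrullDim (S ⧸ K ⊔ I ⊔ Ideal.span {x}) ≤ m) :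
    ∃ u ∈ I, ringKrullDim (S ⧸ K ⊔ Ideal.span {x + u}) ≤ m := by
  obtain ⟨u, hu, hux⟩ := exists_add_notMem_of_isAntichain (I := I) (x := x)
    (T := {Q ∈ K.minimalPrimes | ¬ ringKrullDim (S ⧸ Q) ≤ m})
    ((K.finite_minimalPrimes_of_isNoetherianRing S).subset fun _ h => h.1) (fun Q hQ => hQ.1.1.1)
    ((setOfPred_minimal_antichain _).subset fun _ h => h.1) (fun Q hQ hle =>
      hQ.2 ((ringKrullDim_quotient_antitone (by
        rw [sup_assoc]; exact sup_le hQ.1.1.2 hle)).trans hKI))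
  refine ⟨u, hu, ringKrullDim_quotient_le_of_minimalPrimes fun P hP => ?_⟩
  have hPp := hP.1.1
  obtain ⟨Q, hQ, hQP⟩ := Ideal.exists_minimalPrimes_le (le_sup_left.trans hP.1.2 : K ≤ P)
  have := hQ.1.1
  by_cases hQm : ringKrullDim (S ⧸ Q) ≤ m
  · exact (ringKrullDim_quotient_antitone hQP).trans hQm
  · have hxP : x + u ∈ P := hP.1.2 (Ideal.mem_sup_right (Ideal.mem_span_singleton_self _))
    have hlt : Q < P := lt_of_le_of_ne hQP fun h => hux Q ⟨hQ, hQm⟩ (h ▸ hxP)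
    exact le_of_add_natCast_le (n := 1) (by
      exact_mod_cast ((ringKrullDim_quotient_add_one_le hlt).trans
        ((ringKrullDim_quotient_antitone hQ.1.2).trans hK)))

variable [IsLocalRing S]

theorem maximalIdeal_le_radical_of_ringKrullDim_le_zero {K : Ideal S}
    (h : ringKrullDim (S ⧸ K) ≤ 0) : maximalIdeal S ≤ K.radical := by
  rw [Ideal.radical_eq_sInf]
  refine le_sInf fun P ⟨hKP, hP⟩ => ?_
  by_contra hcon
  have h1 := ringKrullDim_quotient_add_one_le (lt_of_le_not_ge (le_maximalIdeal hP.ne_top) hcon)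
  have h2 : ringKrullDim (S ⧸ maximalIdeal S) + 1 ≤ ((0 : ℕ) : WithBot ℕ∞) :=
    h1.trans ((ringKrullDim_quotient_antitone hKP).trans h)
  have h3 : (0 : WithBot ℕ∞) ≤ ringKrullDim (S ⧸ maximalIdeal S) :=
    ringKrullDim_nonneg_of_nontrivial
  have h4 : (0 : WithBot ℕ∞) + 1 ≤ ((0 : ℕ) : WithBot ℕ∞) := le_trans (by gcongr) h2
  exact absurd h4 (by decide)

theorem ringKrullDim_le_zero_of_maximalIdeal_le_radical {K : Ideal S}
    (h : maximalIdeal S ≤ K.radical) : ringKrullDim (S ⧸ K) ≤ 0 := by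
  refine ringKrullDim_quotient_le_of_minimalPrimes fun P hP => ?_
  have hP' := hP.1.1
  have : P = maximalIdeal S :=
    le_antisymm (le_maximalIdeal hP'.ne_top) (h.trans (hP'.radical_le_iff.2 hP.1.2))
  subst this
  let := Ideal.Quotient.field (maximalIdeal S)
  exact (ringKrullDim_eq_zero_of_field (S ⧸ maximalIdeal S)).le

variable [IsNoetherianRing S]

theorem ringKrullDim_quotient_le_sup_span_add_one (K : Ideal S) {x : S}
    (hx : x ∈ maximalIdeal S) :
    ringKrullDim (S ⧸ K) ≤ ringKrullDim (S ⧸ K ⊔ Ideal.span {x}) + 1 := by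
  rcases eq_or_ne K ⊤ with rfl | hK
  · rw [ringKrullDim_eq_bot_of_subsingleton]
    exact bot_le
  · have := Ideal.Quotient.nontrivial_iff.2 hK
    have : IsLocalRing (S ⧸ K) := .of_surjective' _ Ideal.Quotient.mk_surjective
    have hx' : Ideal.Quotient.mk K x ∈ maximalIdeal (S ⧸ K) := by
      rw [mem_maximalIdeal, mem_nonunits_iff, isUnit_iff_exists_inv]
      rintro ⟨y, hy⟩
      obtain ⟨y, rfl⟩ := Ideal.Quotient.mk_surjective y
      rw [← map_mul, ← map_one (Ideal.Quotient.mk K), Ideal.Quotient.eq] at hy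
      have h1 := (maximalIdeal S).sub_mem (Ideal.mul_mem_right y _ hx) (le_maximalIdeal hK hy)
      rw [sub_sub_cancel] at h1
      exact (Ideal.ne_top_iff_one _).1 (maximalIdeal.isMaximal S).ne_top h1
    have h := ringKrullDim_le_ringKrullDim_quotient_add_card
      ({Ideal.Quotient.mk K x} : Finset (S ⧸ K))
      (by simpa [IsLocalRing.ringJacobson_eq_maximalIdeal] using hx')
    rw [Finset.card_singleton, Finset.coe_singleton, ← Set.image_singleton, ← Ideal.map_span,
      ringKrullDim_eq_of_ringEquiv (DoubleQuot.quotQuotEquivQuotSup K (Ideal.span {x}))] at h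
    exact_mod_cast h

theorem ringKrullDim_quotient_le_sup_span_range_add {d : ℕ} (K : Ideal S) (x : Fin d → S)
    (hx : ∀ i, x i ∈ maximalIdeal S) :
    ringKrullDim (S ⧸ K) ≤ ringKrullDim (S ⧸ K ⊔ Ideal.span (Set.range x)) + d := by
  induction d generalizing K with
  | zero => rw [Set.range_eq_empty, Ideal.span_empty, sup_bot_eq, Nat.cast_zero, add_zero]
  | succ d ih =>
    refine (ringKrullDim_quotient_le_sup_span_add_one K (hx 0)).trans ?_
    have h := ih (K ⊔ Ideal.span {x 0}) (Fin.tail x) fun i => hx _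
    have h1 : K ⊔ Ideal.span (Set.range x) =
        K ⊔ Ideal.span {x 0} ⊔ Ideal.span (Set.range (Fin.tail x)) := by
      rw [sup_assoc, ← Ideal.span_union, ← Set.insert_eq, ← Fin.range_cons, Fin.cons_self_tail]
    rw [h1, Nat.cast_succ, ← add_assoc]
    gcongr

/-- Elements whose images are parameters modulo `I` can be moved within their cosets of `I` so as
to become parameters modulo `K`. -/
theorem exists_lift_ringKrullDim_quotient_le {d m : ℕ} (K I : Ideal S) (x : Fin d → S)
    (hx : ∀ i, x i ∈ maximalIdeal S) (hK : ringKrullDim (S ⧸ K) ≤ (m + d : ℕ))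
    (hKI : ringKrullDim (S ⧸ K ⊔ I ⊔ Ideal.span (Set.range x)) ≤ m) :
    ∃ y : Fin d → S, (∀ i, y i - x i ∈ I) ∧
      ringKrullDim (S ⧸ K ⊔ Ideal.span (Set.range y)) ≤ m := by
  induction d generalizing K with
  | zero => exact ⟨x, fun i => i.elim0, by
      rwa [Set.range_eq_empty, Ideal.span_empty, sup_bot_eq]⟩
  | succ d ih =>
    have hr : ∀ z : Fin (d + 1) → S, Ideal.span (Set.range z) =
        Ideal.span {z 0} ⊔ Ideal.span (Set.range (Fin.tail z)) := fun z => by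
      rw [← Ideal.span_union, ← Set.insert_eq, ← Fin.range_cons, Fin.cons_self_tail]
    obtain ⟨u, hu, hKu⟩ := exists_ringKrullDim_quotient_sup_span_le (m := m + d) (x := x 0) hK (by
      refine (ringKrullDim_quotient_le_sup_span_range_add _ (Fin.tail x) fun i => hx _).trans ?_
      rw [sup_assoc _ (Ideal.span {x 0}), ← hr, Nat.cast_add]
      gcongr)
    obtain ⟨y, hy, hyK⟩ := ih (K ⊔ Ideal.span {x 0 + u}) (Fin.tail x) (fun i => hx _) hKu (by
      refine (ringKrullDim_quotient_antitone ?_).trans hKI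
      rw [hr, ← sup_assoc]
      refine sup_le_sup_right (sup_le (sup_le_sup_right le_sup_left I) ?_) _
      rw [Ideal.span_singleton_le_iff_mem]
      exact (Submodule.add_mem_iff_left _ (Ideal.mem_sup_right hu)).1
        (Ideal.mem_sup_left (Ideal.mem_sup_right (Ideal.mem_span_singleton_self (x 0 + u)))))
    refine ⟨Fin.cons (x 0 + u) y, Fin.forall_fin_succ.2 ⟨by simpa using hu, by
      simpa [Fin.tail] using hy⟩, ?_⟩
    rw [hr, ← sup_assoc]
    exact hyK

end Dimension

/-! ### Uniform colon capturing -/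

section Colon

theorem IsCohenMacaulayLocalRing.exists_isRegular {S : Type*} [CommRing S] [IsLocalRing S]
    (hS : IsCohenMacaulayLocalRing S) : ∃ rs : List S, IsRegular S rs ∧
      (∀ r ∈ rs, r ∈ maximalIdeal S) ∧ ringKrullDim S = rs.length := by
  have := hS.noetherian
  obtain ⟨n, hn⟩ : ∃ n : ℕ, localDepth S = n := by
    have h1 : localDepth S ≠ ⊤ := fun h => by
      have h2 := hS.depth_eq
      rw [h] at h2
      exact ringKrullDim_ne_top h2.symm
    exact ⟨_, (ENat.natCast_toNat h1).symm⟩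
  have hle : ∀ rs : List S, IsRegular S rs → (∀ r ∈ rs, r ∈ maximalIdeal S) → rs.length ≤ n :=
    fun rs h1 h2 => by
      have : (rs.length : ℕ∞) ≤ localDepth S :=
        le_iSup₂_of_le (f := fun (rs : List S) (_ : IsRegular S rs ∧
          ∀ r ∈ rs, r ∈ maximalIdeal S) => (rs.length : ℕ∞)) rs ⟨h1, h2⟩ le_rfl
      rw [hn] at this
      exact_mod_cast this
  obtain ⟨rs, h1, h2, h3⟩ : ∃ rs : List S, IsRegular S rs ∧
      (∀ r ∈ rs, r ∈ maximalIdeal S) ∧ n ≤ rs.length := by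
    cases n with
    | zero => exact ⟨[], .nil S S, by simp, by simp⟩
    | succ n =>
      have h : (n : ℕ∞) < localDepth S := by
        rw [hn]
        exact_mod_cast n.lt_succ_self
      simp only [localDepth, lt_iSup_iff] at h
      obtain ⟨rs, ⟨h1, h2⟩, h3⟩ := h
      exact ⟨rs, h1, h2, by exact_mod_cast h3⟩
  refine ⟨rs, h1, h2, ?_⟩
  rw [← hS.depth_eq, hn, le_antisymm h3 (hle rs h1 h2)]
  rfl

/-- If `dim S/K ≤ d`, then no prime over `K` lies strictly below the preimage of a prime `P` with
`dim R/P = d`. -/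
theorem eq_comap_of_ringKrullDim_quotient_le {S R : Type*} [CommRing S] [CommRing R] {d : ℕ}
    {f : S →+* R} (hf : Function.Surjective f) {K : Ideal S} (hK : ringKrullDim (S ⧸ K) ≤ d)
    {P : Ideal R} (hP : ringKrullDim (R ⧸ P) = d) {Q : Ideal S} [Q.IsPrime] (hKQ : K ≤ Q)
    (hQ : Q ≤ P.comap f) : Q = P.comap f := by
  by_contra hne
  have h1 := ringKrullDim_quotient_add_one_le (lt_of_le_of_ne hQ hne)
  have h2 : ringKrullDim (S ⧸ P.comap f) = d := by
    rw [← hP]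
    refine ringKrullDim_eq_of_ringEquiv (RingEquiv.ofBijective (Ideal.quotientMap P f le_rfl)
      ⟨Ideal.quotientMap_injective, Ideal.quotientMap_surjective hf⟩)
  rw [h2] at h1
  have h3 := h1.trans ((ringKrullDim_quotient_antitone hKQ).trans hK)
  have h4 : d + 1 ≤ d := by exact_mod_cast h3
  omega

/-- **Uniform colon capturing.** One element `c` of `R°` multiplies every coefficient of a relation
between arbitrary positive powers of the parameters into the ideal generated by the other powers. -/
theorem exists_mul_mem_span_of_isRegular.{u, v} {S : Type u} {R : Type v} [CommRing S]
    [IsLocalRing S] [IsNoetherianRing S] [CommRing R] [IsLocalRing R] [IsNoetherianRing R]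
    (hequi : IsEquidimensional R) {rs : List S} (hreg : IsRegular S rs)
    (hrsm : ∀ r ∈ rs, r ∈ maximalIdeal S) (hdim : ringKrullDim S = rs.length)
    {f : S →+* R} (hf : Function.Surjective f) {d : ℕ} {x : Fin d → R}
    (hx : IsSystemOfParameters x) :
    ∃ c ∈ avoidMinimalPrimes R, ∀ k : Fin d → ℕ, (∀ j, 1 ≤ k j) → ∀ z : Fin d → R,
      ∑ j, x j ^ k j * z j = 0 → ∀ i,
        c * z i ∈ Ideal.span ((fun j => x j ^ k j) '' {i}ᶜ) := by
  set I := RingHom.ker f with hI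
  have hcm : (maximalIdeal R).comap f = maximalIdeal S :=
    have := Ideal.comap_isMaximal_of_surjective f hf (K := maximalIdeal R)
    eq_maximalIdeal this
  have hIm : I ≤ maximalIdeal S := hcm ▸ Ideal.ker_le_comap f
  have hxm : ∀ j, x j ∈ maximalIdeal R := fun j => by
    rw [← hx.radical_eq]
    exact Ideal.le_radical (Ideal.subset_span ⟨j, rfl⟩)
  have hlift : ∀ {s : S} {j}, f s = x j → s ∈ maximalIdeal S := fun {s j} h => by
    rw [← hcm, Ideal.mem_comap, h]
    exact hxm j
  have hdI : ringKrullDim (S ⧸ I) = d := by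
    rw [← hx.dim_eq]
    exact ringKrullDim_eq_of_ringEquiv (RingHom.quotientKerEquivOfSurjective hf)
  have hdn : d ≤ rs.length := by
    have h := ringKrullDim_quotient_le I
    rw [hdI, hdim] at h
    exact_mod_cast h
  obtain ⟨h, hh⟩ := Nat.exists_eq_add_of_le hdn
  -- `h = dim S - d` elements of the kernel cut `S` down to dimension `d`
  obtain ⟨y, hy, hyd⟩ := exists_lift_ringKrullDim_quotient_le (d := h) (m := d) ⊥ I 0
    (fun i => zero_mem _) (by
      rw [← hh, ← hdim]
      exact ringKrullDim_quotient_le _) ((ringKrullDim_quotient_antitone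
        (le_sup_right.trans le_sup_left)).trans hdI.le)
  simp only [Pi.zero_apply, sub_zero] at hy
  rw [bot_sup_eq] at hyd
  set K := Ideal.span (Set.range y) with hKdef
  have hKI : K ≤ I := Ideal.span_le.2 (by rintro _ ⟨i, rfl⟩; exact hy i)
  choose xt hxt using fun j => hf (x j)
  have hrad : maximalIdeal S ≤ (I ⊔ Ideal.span (Set.range xt)).radical := by
    have h1 : I ⊔ Ideal.span (Set.range xt) = (Ideal.span (Set.range x)).comap f := by
      have : Ideal.span (Set.range x) = (Ideal.span (Set.range xt)).map f := by
        rw [Ideal.map_span, ← Set.range_comp]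
        congr 2
        exact funext fun j => (hxt j).symm
      rw [this, Ideal.comap_map_of_surjective f hf, sup_comm]
      rfl
    rw [h1, ← Ideal.comap_radical, hx.radical_eq, hcm]
  -- the parameters lift to elements that are parameters modulo `K`
  obtain ⟨x', hx', hx'd⟩ := exists_lift_ringKrullDim_quotient_le (d := d) (m := 0) K I xt
    (fun i => hlift (hxt i)) (by rwa [zero_add]) ((ringKrullDim_quotient_antitone
        (sup_le_sup_right le_sup_right _)).trans
          (ringKrullDim_le_zero_of_maximalIdeal_le_radical hrad))
  have hfx' : ∀ j, f (x' j) = x j := fun j => by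
    have := hx' j
    rw [hI, RingHom.mem_ker, map_sub, sub_eq_zero] at this
    rw [this, hxt]
  have hrad' := maximalIdeal_le_radical_of_ringKrullDim_le_zero hx'd
  have hrsrad : maximalIdeal S ≤ (⊥ ⊔ Ideal.ofList rs).radical := by
    rw [bot_sup_eq]
    refine maximalIdeal_le_radical_of_ringKrullDim_le_zero
      (le_of_add_natCast_le (m := 0) (n := rs.length) ?_)
    rw [ringKrullDim_add_length_eq_ringKrullDim_of_isRegular rs hreg, hdim, zero_add]
  have hxreg : ∀ k : Fin d → ℕ, (∀ j, 1 ≤ k j) →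
      IsWeaklyRegular (S ⧸ (K • ⊤ : Submodule S S)) (List.ofFn fun j => x' j ^ k j) := by
    intro k hk
    have h1 : IsWeaklyRegular S (List.ofFn y ++ List.ofFn fun j => x' j ^ k j) := by
      refine isWeaklyRegular_of_maximalIdeal_le_radical rs.length S ⊥ bot_le
        (fun k hk v => by rw [(Submodule.mem_bot S).1 hk, zero_smul]) rs _ rfl
        (by simp [hh, add_comm]) hrsm ?_ hrsrad ?_ hreg.toIsWeaklyRegular
      · intro a ha
        rw [List.mem_append, List.mem_ofFn, List.mem_ofFn] at ha
        rcases ha with ⟨i, rfl⟩ | ⟨i, rfl⟩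
        · exact hIm (hy i)
        · exact Ideal.pow_mem_of_mem _ (hlift (hfx' i)) _ (hk i)
      · rw [bot_sup_eq, Ideal.ofList_append, ofList_ofFn, ofList_ofFn]
        refine hrad'.trans (Ideal.radical_le_radical_iff.2 (sup_le
          (le_sup_left.trans Ideal.le_radical) (Ideal.span_le.2 ?_)))
        rintro _ ⟨i, rfl⟩
        exact ⟨k i, Ideal.mem_sup_right (Ideal.subset_span ⟨i, rfl⟩)⟩
    rw [isWeaklyRegular_append_iff, ofList_ofFn] at h1
    exact h1.2
  have hass : ∀ Q : Ideal S, Q.IsPrime → K ≤ Q →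
      (∀ c ∈ (avoidMinimalPrimes R).comap f, c ∉ Q) →
      IsAssociatedPrime Q (S ⧸ (K • ⊤ : Submodule S S)) := by
    intro Q hQ hKQ hQW
    obtain ⟨P, hP, hQP⟩ := (Ideal.subset_union_prime_finite
      (minimalPrimes.finite_of_isNoetherianRing R) (f := fun P => P.comap f) ⊤ ⊤
      (fun P hP _ _ => have := hP.1.1; Ideal.comap_isPrime f P) (I := Q)).1 fun c hc => by
        by_contra hcon
        refine hQW c (fun P hP hcP => hcon ?_) hc
        exact Set.mem_biUnion hP hcP
    have hdP : ringKrullDim (R ⧸ P) = d := (hequi P hP).trans hx.dim_eq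
    have hQeq := eq_comap_of_ringKrullDim_quotient_le hf hyd hdP hKQ hQP
    refine Module.associatedPrimes.minimalPrimes_annihilator_subset_associatedPrimes S _ ?_
    have hann : Module.annihilator S (S ⧸ (K • ⊤ : Submodule S S)) = K := by
      rw [smul_eq_mul, Ideal.mul_top]
      exact Ideal.annihilator_quotient
    rw [hann]
    refine ⟨⟨hQ, hKQ⟩, fun Q' ⟨hQ', hKQ'⟩ hle => ?_⟩
    have := hQ'
    rw [eq_comap_of_ringKrullDim_quotient_le hf hyd hdP hKQ' (hle.trans hQP)]
    exact hQP
  obtain ⟨c, hc, hcx⟩ := exists_killsKoszulRelations (S ⧸ (K • ⊤ : Submodule S S)) K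
    (fun k hk v => by
      obtain ⟨v, rfl⟩ := Submodule.Quotient.mk_surjective _ v
      rw [← Submodule.Quotient.mk_smul, Submodule.Quotient.mk_eq_zero]
      exact Submodule.smul_mem_smul hk trivial)
    ((avoidMinimalPrimes R).comap f) hass d (S ⧸ I) (fun k hk v => by
      obtain ⟨v, rfl⟩ := Submodule.Quotient.mk_surjective _ v
      rw [← Submodule.Quotient.mk_smul, Submodule.Quotient.mk_eq_zero]
      exact I.mul_mem_right v (hKI hk))
  refine ⟨f c, hc, fun k hk z hz i => ?_⟩
  choose ζ hζ using fun j => hf (z j)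
  obtain ⟨s, hs⟩ := hcx _ (hxreg k hk) (fun j => Submodule.mkQ I (ζ j)) (by
    simp only [← map_smul, ← map_sum]
    rw [Submodule.mkQ_apply, Submodule.Quotient.mk_eq_zero, hI, RingHom.mem_ker]
    simpa [hfx', hζ] using hz)
  choose σ hσ using fun j l => Submodule.Quotient.mk_surjective I (s j l)
  have h1 : c • ζ i - ∑ l, (x' l ^ k l) • (σ i l - σ l i) ∈ I := by
    rw [← Submodule.Quotient.mk_eq_zero I, ← Submodule.mkQ_apply]
    simp only [map_sub, map_smul, map_sum, Submodule.mkQ_apply, hσ]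
    rw [← hs i, Submodule.mkQ_apply, sub_self]
  rw [hI, RingHom.mem_ker] at h1
  simp only [map_sub, map_sum, smul_eq_mul, map_mul, map_pow, hfx', hζ, sub_eq_zero] at h1
  rw [h1]
  refine sum_mem fun l _ => ?_
  by_cases hl : l = i
  · rw [hl, sub_self, mul_zero]
    exact zero_mem _
  · exact Ideal.mul_mem_right _ _ (Ideal.subset_span ⟨l, hl, rfl⟩)

theorem exists_mul_mem_span {R : Type*} [CommRing R] [IsLocalRing R] [IsNoetherianRing R]
    (hequi : IsEquidimensional R) {S : Type*} [CommRing S] (hS : IsCohenMacaulayRing S)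
    {f : S →+* R} (hf : Function.Surjective f) {d : ℕ} {x : Fin d → R}
    (hx : IsSystemOfParameters x) :
    ∃ c ∈ avoidMinimalPrimes R, ∀ k : Fin d → ℕ, (∀ j, 1 ≤ k j) → ∀ z : Fin d → R,
      ∑ j, x j ^ k j * z j = 0 → ∀ i,
        c * z i ∈ Ideal.span ((fun j => x j ^ k j) '' {i}ᶜ) := by
  have hM : ((maximalIdeal R).comap f).IsMaximal :=
    Ideal.comap_isMaximal_of_surjective f hf
  have hCM := hS.localization ((maximalIdeal R).comap f)
  have := hCM.noetherian
  obtain ⟨rs, hreg, hrs, hdim⟩ := hCM.exists_isRegular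
  let g : Localization.AtPrime ((maximalIdeal R).comap f) →+* R :=
    IsLocalization.lift (M := ((maximalIdeal R).comap f).primeCompl) (g := f) fun s => by
      by_contra h
      exact s.2 h
  have hg : Function.Surjective g := fun r => by
    obtain ⟨s, rfl⟩ := hf r
    exact ⟨algebraMap S _ s, IsLocalization.lift_eq _ s⟩
  exact exists_mul_mem_span_of_isRegular hequi hreg hrs hdim hg hx

end Colon

/-! ### Lengths and tight closure -/

section Length

variable {R : Type*} [CommRing R]

theorem length_quotient_anti {A B : Ideal R} (h : A ≤ B) :
    Module.length R (R ⧸ B) ≤ Module.length R (R ⧸ A) :=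
  Module.length_le_of_surjective (Submodule.factor h) (Submodule.factor_surjective h)

theorem length_quotient_add_le {A B : Ideal R} {y : R} (h : ∀ z, y * z ∈ A → z ∈ B) :
    Module.length R (R ⧸ B) + Module.length R (R ⧸ A ⊔ Ideal.span {y}) ≤
      Module.length R (R ⧸ A) := by
  let φ : R →ₗ[R] R ⧸ A := Submodule.mkQ A ∘ₗ LinearMap.mulLeft R y
  have hφ : ∀ z, φ z = Submodule.Quotient.mk (y * z) := fun z => rfl
  have hker : LinearMap.ker φ ≤ B := fun z hz => h z (by
    rwa [LinearMap.mem_ker, hφ, Submodule.Quotient.mk_eq_zero] at hz)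
  rw [Module.length_eq_add_of_exact ((LinearMap.ker φ).liftQ φ le_rfl)
    (Submodule.factor (le_sup_left : A ≤ A ⊔ Ideal.span {y}))
    (LinearMap.ker_eq_bot.1 (Submodule.ker_liftQ_eq_bot' _ _ rfl)) (Submodule.factor_surjective _)]
  · gcongr
    exact length_quotient_anti hker
  · intro v
    obtain ⟨v, rfl⟩ := Submodule.Quotient.mk_surjective _ v
    rw [← LinearMap.coe_range, SetLike.mem_coe, Submodule.range_liftQ]
    constructor
    · intro hv
      have hv' : v ∈ A ⊔ Ideal.span {y} := (Submodule.Quotient.mk_eq_zero _).1 hv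
      obtain ⟨a, ha, b, hb, rfl⟩ := Submodule.mem_sup.1 hv'
      obtain ⟨t, rfl⟩ := Ideal.mem_span_singleton.1 hb
      refine ⟨t, ?_⟩
      rw [hφ, Submodule.Quotient.eq]
      simpa using A.neg_mem ha
    · rintro ⟨t, ht⟩
      rw [← ht, hφ]
      exact (Submodule.Quotient.mk_eq_zero _).2
        (Ideal.mem_sup_right (Ideal.mem_span_singleton.2 (dvd_mul_right y t)))

theorem eq_of_length_quotient_le {A B : Ideal R} (h : A ≤ B)
    (hfin : Module.length R (R ⧸ B) ≠ ⊤)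
    (hle : Module.length R (R ⧸ A) ≤ Module.length R (R ⧸ B)) : A = B := by
  have h1 := Module.length_eq_add_of_exact (LinearMap.ker (Submodule.factor h)).subtype
    (Submodule.factor h) (Submodule.subtype_injective _) (Submodule.factor_surjective h)
    (LinearMap.exact_subtype_ker_map _)
  rw [h1] at hle
  have h2 : Module.length R (LinearMap.ker (Submodule.factor h)) = 0 := by
    have h3 : Module.length R (LinearMap.ker (Submodule.factor h)) + Module.length R (R ⧸ B) ≤
      0 + Module.length R (R ⧸ B) := by rwa [zero_add]
    exact le_antisymm ((ENat.add_le_add_iff_right hfin).1 h3) zero_le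
  rw [Module.length_eq_zero_iff] at h2
  refine le_antisymm h fun b hb => ?_
  have h3 : (Submodule.Quotient.mk b : R ⧸ A) ∈ LinearMap.ker (Submodule.factor h) :=
    (Submodule.Quotient.mk_eq_zero B).2 hb
  have h4 := congrArg Subtype.val (Subsingleton.elim
    (⟨_, h3⟩ : LinearMap.ker (Submodule.factor h)) 0)
  exact (Submodule.Quotient.mk_eq_zero A).1 h4

theorem length_quotient_ne_top [IsLocalRing R] [IsNoetherianRing R] {J : Ideal R}
    (hJ : J.radical = maximalIdeal R) : Module.length R (R ⧸ J) ≠ ⊤ := by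
  have hmin : maximalIdeal R ∈ J.minimalPrimes :=
    ⟨⟨inferInstance, hJ ▸ Ideal.le_radical⟩, fun P ⟨hP, hle⟩ _ =>
      hJ ▸ hP.radical_le_iff.2 hle⟩
  have := quotient_artinian_of_mem_minimalPrimes_of_isLocalRing J hmin
  rw [Module.length_eq_of_surjective (S := R) (R := R ⧸ J) (M := R ⧸ J)
    Ideal.Quotient.mk_surjective]
  exact Module.length_ne_top

end Length

section TightClosure

variable {R : Type*} [CommRing R] (p : ℕ) [Fact p.Prime] [CharP R p]

theorem frobeniusPower_mono {I J : Ideal R} (h : I ≤ J) (q : ℕ) :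
    frobeniusPower I q ≤ frobeniusPower J q :=
  Ideal.span_mono fun _ ⟨a, ha, hb⟩ => ⟨a, h ha, hb⟩

theorem tightClosure_mono {I J : Ideal R} (h : I ≤ J) : tightClosure p I ≤ tightClosure p J :=
  fun _ ⟨c, hc, e₀, he⟩ => ⟨c, hc, e₀, fun e hle => frobeniusPower_mono h _ (he e hle)⟩

theorem le_tightClosure (I : Ideal R) : I ≤ tightClosure p I := fun z hz =>
  ⟨1, one_mem _, 0, fun e _ => by
    rw [one_mul]
    exact Ideal.subset_span ⟨z, hz, rfl⟩⟩

theorem frobeniusPower_span_range {ι : Type*} [Fintype ι] (g : ι → R) (e : ℕ) :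
    frobeniusPower (Ideal.span (Set.range g)) (p ^ e) =
      Ideal.span (Set.range fun i => g i ^ p ^ e) := by
  refine le_antisymm (Ideal.span_le.2 ?_) (Ideal.span_le.2 ?_)
  · rintro _ ⟨a, ha, rfl⟩
    obtain ⟨c, rfl⟩ := Ideal.mem_span_range_iff_exists_fun.1 ha
    rw [sum_pow_char_pow]
    refine sum_mem fun i _ => ?_
    rw [mul_pow]
    exact Ideal.mul_mem_left _ _ (Ideal.subset_span ⟨i, rfl⟩)
  · rintro _ ⟨i, rfl⟩
    exact Ideal.subset_span ⟨g i, Ideal.subset_span ⟨i, rfl⟩, rfl⟩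

variable {d : ℕ} {x : Fin d → R}

/-- `(x₁^{k₁}, …, xᵢ^{kᵢ + 1}, …, x_d^{k_d})^* : xᵢ ⊆ (x₁^{k₁}, …, x_d^{k_d})^*` in the presence of
a uniform multiplier for relations between powers of the parameters. -/
theorem mem_tightClosure_of_mul_mem {c : R} (hc : c ∈ avoidMinimalPrimes R)
    (hcolon : ∀ k : Fin d → ℕ, (∀ j, 1 ≤ k j) → ∀ z : Fin d → R, ∑ j, x j ^ k j * z j = 0 →
      ∀ i, c * z i ∈ Ideal.span ((fun j => x j ^ k j) '' {i}ᶜ))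
    {k : Fin d → ℕ} (hk : ∀ j, 1 ≤ k j) (i : Fin d) {z : R}
    (hz : x i * z ∈ tightClosure p
      (Ideal.span (Set.range fun j => x j ^ Function.update k i (k i + 1) j))) :
    z ∈ tightClosure p (Ideal.span (Set.range fun j => x j ^ k j)) := by
  obtain ⟨b, hb, e₀, h⟩ := hz
  refine ⟨c * b, mul_mem hc hb, e₀, fun e he => ?_⟩
  have hq : 1 ≤ p ^ e := Nat.one_le_pow _ _ (Fact.out : p.Prime).pos
  have h1 := h e he
  rw [frobeniusPower_span_range] at h1 ⊢
  obtain ⟨a, ha⟩ := Ideal.mem_span_range_iff_exists_fun.1 h1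
  set q := p ^ e
  -- cancelling `xᵢ ^ q` from the `i`-th term leaves a relation between powers of the parameters
  have hrel := hcolon (Function.update (fun j => k j * q) i q) (fun j => by
      by_cases hj : j = i
      · subst hj
        simpa using hq
      · rw [Function.update_of_ne hj]
        exact Nat.mul_pos (hk j) hq)
    (Function.update (fun j => -a j) i (b * z ^ q - a i * x i ^ (k i * q))) (by
      rw [Fintype.sum_eq_add_sum_compl i] at ha ⊢
      simp only [Function.update_self] at ha ⊢
      have h2 : ∑ j ∈ {i}ᶜ, x j ^ Function.update (fun j => k j * q) i q j *
          Function.update (fun j => -a j) i (b * z ^ q - a i * x i ^ (k i * q)) j =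
          - ∑ j ∈ {i}ᶜ, a j * (x j ^ Function.update k i (k i + 1) j) ^ q := by
        rw [← Finset.sum_neg_distrib]
        refine Finset.sum_congr rfl fun j hj => ?_
        have hj' : j ≠ i := by simpa using hj
        simp only [Function.update_of_ne hj']
        rw [pow_mul]
        ring
      rw [h2, eq_sub_of_add_eq' ha, pow_mul]
      ring) i
  rw [Function.update_self] at hrel
  have h3 : c * b * z ^ q = c * (b * z ^ q - a i * x i ^ (k i * q)) +
      c * a i * (x i ^ k i) ^ q := by
    rw [pow_mul]
    ring
  rw [h3]
  refine add_mem (Ideal.span_mono ?_ hrel) (Ideal.mul_mem_left _ _ (Ideal.subset_span ⟨i, rfl⟩))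
  rintro _ ⟨j, hj, rfl⟩
  have hj' : j ≠ i := hj
  refine ⟨j, ?_⟩
  simp only [Function.update_of_ne hj', pow_mul]

/-- The contribution to the length of one more power of `xᵢ`. The ideal `T + (xᵢ)` is kept as it is,
since in the case of equality it is this ideal that has to be identified. -/
theorem length_quotient_tightClosure_add_le {c : R} (hc : c ∈ avoidMinimalPrimes R)
    (hcolon : ∀ k : Fin d → ℕ, (∀ j, 1 ≤ k j) → ∀ z : Fin d → R, ∑ j, x j ^ k j * z j = 0 →
      ∀ i, c * z i ∈ Ideal.span ((fun j => x j ^ k j) '' {i}ᶜ))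
    {k : Fin d → ℕ} (hk : ∀ j, 1 ≤ k j) (i : Fin d) :
    Module.length R (R ⧸ tightClosure p (Ideal.span (Set.range fun j => x j ^ k j))) +
      Module.length R (R ⧸ tightClosure p (Ideal.span
        (Set.range fun j => x j ^ Function.update k i (k i + 1) j)) ⊔ Ideal.span {x i}) ≤
      Module.length R (R ⧸ tightClosure p (Ideal.span
        (Set.range fun j => x j ^ Function.update k i (k i + 1) j))) :=
  length_quotient_add_le fun _ => mem_tightClosure_of_mul_mem p hc hcolon hk i

theorem tightClosure_update_sup_le (k : Fin d → ℕ) (i : Fin d) {m : ℕ} (hm : 1 ≤ m) :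
    tightClosure p (Ideal.span (Set.range fun j => x j ^ Function.update k i m j)) ⊔
      Ideal.span {x i} ≤
      tightClosure p (Ideal.span (Set.range fun j => x j ^ Function.update k i 1 j)) := by
  have hxi : x i ∈ Ideal.span (Set.range fun j => x j ^ Function.update k i 1 j) :=
    Ideal.subset_span ⟨i, by simp⟩
  refine sup_le (tightClosure_mono p (Ideal.span_le.2 ?_))
    ((Ideal.span_singleton_le_iff_mem _).2 (le_tightClosure p _ hxi))
  rintro _ ⟨j, rfl⟩
  by_cases hj : j = i
  · subst hj
    simp only [Function.update_self]
    exact Ideal.pow_mem_of_mem _ hxi _ hm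
  · exact Ideal.subset_span ⟨j, by simp [hj]⟩

theorem mul_length_le_length_update {c : R} (hc : c ∈ avoidMinimalPrimes R)
    (hcolon : ∀ k : Fin d → ℕ, (∀ j, 1 ≤ k j) → ∀ z : Fin d → R, ∑ j, x j ^ k j * z j = 0 →
      ∀ i, c * z i ∈ Ideal.span ((fun j => x j ^ k j) '' {i}ᶜ))
    {k : Fin d → ℕ} (hk : ∀ j, 1 ≤ k j) (i : Fin d) {m : ℕ} (hm : 1 ≤ m) :
    (m : ℕ∞) * Module.length R (R ⧸ tightClosure p
        (Ideal.span (Set.range fun j => x j ^ Function.update k i 1 j))) ≤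
      Module.length R (R ⧸ tightClosure p
        (Ideal.span (Set.range fun j => x j ^ Function.update k i m j))) := by
  induction m, hm using Nat.le_induction with
  | base => simp
  | succ m hm ih =>
    have h := length_quotient_tightClosure_add_le p hc hcolon (k := Function.update k i m)
      (fun j => by
        by_cases hj : j = i
        · subst hj
          simpa using hm
        · simpa [hj] using hk j) i
    rw [Function.update_idem, Function.update_self] at h
    rw [Nat.cast_succ, add_mul, one_mul]
    exact (add_le_add ih
      (length_quotient_anti (tightClosure_update_sup_le p k i m.succ_pos))).trans h

theorem prod_mul_length_le_length {c : R} (hc : c ∈ avoidMinimalPrimes R)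
    (hcolon : ∀ k : Fin d → ℕ, (∀ j, 1 ≤ k j) → ∀ z : Fin d → R, ∑ j, x j ^ k j * z j = 0 →
      ∀ i, c * z i ∈ Ideal.span ((fun j => x j ^ k j) '' {i}ᶜ))
    {k : Fin d → ℕ} (hk : ∀ j, 1 ≤ k j) (s : Finset (Fin d)) :
    ((∏ i ∈ s, k i : ℕ) : ℕ∞) *
        Module.length R (R ⧸ tightClosure p (Ideal.span (Set.range x))) ≤
      Module.length R (R ⧸ tightClosure p
        (Ideal.span (Set.range fun j => x j ^ if j ∈ s then k j else 1))) := by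
  induction s using Finset.induction_on with
  | empty =>
    have h : (fun j => x j ^ if j ∈ (∅ : Finset (Fin d)) then k j else 1) = x := by
      funext j
      simp
    rw [h, Finset.prod_empty, Nat.cast_one, one_mul]
  | insert i s hi ih =>
    have h := mul_length_le_length_update p hc hcolon (k := fun j => if j ∈ s then k j else 1)
      (fun j => by
        by_cases hj : j ∈ s
        · simpa [hj] using hk j
        · simp [hj]) i (hk i)
    have h1 : Function.update (fun j => if j ∈ s then k j else 1) i 1 =
        fun j => if j ∈ s then k j else 1 := by
      rw [Function.update_eq_self_iff]
      simp [hi]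
    have h2 : Function.update (fun j => if j ∈ s then k j else 1) i (k i) =
        fun j => if j ∈ insert i s then k j else 1 := by
      funext j
      by_cases hj : j = i
      · subst hj
        simp
      · simp [hj]
    rw [h1, h2] at h
    rw [Finset.prod_insert hi, Nat.cast_mul, mul_assoc]
    exact (mul_le_mul_right ih _).trans h

end TightClosure

end TightClosureIneq

theorem theorem1p1 {R : Type*} [CommRing R] [IsLocalRing R] [IsNoetherianRing R]
    (p : ℕ) [Fact p.Prime] [CharP R p]
    (hequi : TightClosureIneq.IsEquidimensional R)
    {S : Type*} [CommRing S] (hS : TightClosureIneq.IsCohenMacaulayRing S)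
    (f : S →+* R) (hf : Function.Surjective f)
    {d : ℕ} (x : Fin d → R) (hx : TightClosureIneq.IsSystemOfParameters x) :
    (∀ k : Fin d → ℕ, (∀ i, 1 ≤ k i) →
      ((∏ i, k i : ℕ) : ℕ∞) *
          Module.length R (R ⧸ TightClosureIneq.tightClosure p (Ideal.span (Set.range x))) ≤
        Module.length R (R ⧸ TightClosureIneq.tightClosure p
          (Ideal.span (Set.range fun i => x i ^ k i)))) ∧
    (∀ (i : Fin d) (k : ℕ), 1 ≤ k →
      Module.length R (R ⧸ TightClosureIneq.tightClosure p
          (Ideal.span (Set.range (Function.update x i (x i ^ k))))) =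
        (k : ℕ∞) *
          Module.length R (R ⧸ TightClosureIneq.tightClosure p (Ideal.span (Set.range x))) →
      TightClosureIneq.tightClosure p (Ideal.span (Set.range x)) =
        Ideal.span (Set.range x) ⊔
          TightClosureIneq.tightClosure p
            (Ideal.span (Set.range (Function.update x i (x i ^ k))))) := by

  obtain ⟨c, hc, hcolon⟩ := TightClosureIneq.exists_mul_mem_span hequi hS hf hx
  refine ⟨fun k hk => ?_, fun i k hk hlen => ?_⟩
  · have h := TightClosureIneq.prod_mul_length_le_length p hc hcolon hk Finset.univ
    have hall : (fun j => x j ^ if j ∈ Finset.univ then k j else 1) = fun j => x j ^ k j := by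
      funext j
      simp
    rwa [hall] at h
  · have hupd : ∀ m : ℕ, Function.update x i (x i ^ m) =
        fun j => x j ^ Function.update (fun _ => 1) i m j := fun m => by
      funext j
      by_cases hj : j = i
      · subst hj
        simp
      · simp [hj]
    have hone : (fun j => x j ^ Function.update (fun _ => 1) i 1 j) = x := by
      rw [← hupd, pow_one, Function.update_eq_self]
    obtain rfl | ⟨m, hm, rfl⟩ : k = 1 ∨ ∃ m, 1 ≤ m ∧ k = m + 1 := by
      obtain rfl | hlt := hk.eq_or_lt
      · exact .inl rfl
      · exact .inr ⟨k - 1, by omega, by omega⟩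
    · rw [pow_one, Function.update_eq_self]
      exact (sup_eq_right.2 (TightClosureIneq.le_tightClosure p _)).symm
    · rw [hupd] at hlen ⊢
      have hfin : Module.length R (R ⧸ TightClosureIneq.tightClosure p
          (Ideal.span (Set.range x))) ≠ ⊤ :=
        ne_top_of_le_ne_top (TightClosureIneq.length_quotient_ne_top hx.radical_eq)
          (TightClosureIneq.length_quotient_anti (TightClosureIneq.le_tightClosure p _))
      have hle := TightClosureIneq.tightClosure_update_sup_le p (x := x) (fun _ => 1) i
        (m := m + 1) m.succ_pos
      have h1 := TightClosureIneq.length_quotient_tightClosure_add_le p hc hcolon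
        (k := Function.update (fun _ => 1) i m) (fun j => by
          by_cases hj : j = i
          · subst hj
            simpa using hm
          · simp [hj]) i
      rw [Function.update_idem, Function.update_self] at h1
      have h2 := TightClosureIneq.mul_length_le_length_update p hc hcolon
        (k := fun _ => 1) (fun _ => le_rfl) i hm
      rw [hone] at h2 hle
      rw [hlen, Nat.cast_succ, add_mul, one_mul] at h1
      have heq := TightClosureIneq.eq_of_length_quotient_le hle hfin
        ((ENat.add_le_add_iff_left (WithTop.mul_ne_top (ENat.natCast_ne_top m) hfin)).1
          ((add_le_add_left h2 _).trans h1))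
      refine le_antisymm (heq ▸ sup_le le_sup_right ?_)
        (sup_le (TightClosureIneq.le_tightClosure p _) (le_sup_left.trans hle))
      exact ((Ideal.span_singleton_le_iff_mem _).2 
        (Ideal.subset_span (Set.mem_range_self i))).trans le_sup_left
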